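/- Let $\mathbb K$ be $\mathbb R$ or $\mathbb C$, let $M$ be a smooth manifold (finite-dimensional, Hausdorff, $\sigma$-compact), and let $C^\infty(M)$ be the algebra of smooth $\mathbb K$-valued functions on $M$. Let $A$ be a transitive Lie algebroid over $M$: a finitely generated projective $C^\infty(M)$-module with a Lie bracket and a surjective $C^\infty(M)$-linear Lie morphism $\rho\colon A\to\Gamma(TM)$ (vector fields with coefficients in $\mathbb K$) such that $[a,fb]=f[a,b]+(\rho(a)f)\,b$. Let $L=\ker\rho$, and let $\Omega^n(A)$ be the space of alternating $C^\infty(M)$-multilinear maps $A^n\to C^\infty(M)$. Let $\mathfrak g$ be an $n$-dimensional Lie algebra over $\mathbb K$ with basis $(E_a)$ and dual basis $(\theta^a)$. Let $\{(U_i,\Psi_i,\nabla^{0,i})\}_{i\in I}$ be a Lie algebroid atlas of $A$: the open sets $U_i$ cover $M$; $\Psi_i\colon U_i\times\mathfrak g\to L_{U_i}$ is a trivialization of $L$ as a bundle of Lie algebras; $\nabla^{0,i}\colon\Gamma(TU_i)\to A_{U_i}$ is a $C^\infty(U_i)$-linear Lie morphism with $\rho\circ\nabla^{0,i}=\mathrm{id}$;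 and $[\nabla^{0,i}_X,\Psi_i(\gamma)]=\Psi_i(X\cdot\gamma)$. Put $S_i(X\oplus\gamma)=\nabla^{0,i}_X+\Psi_i(\gamma)$, an isomorphism from the trivial Lie algebroid $\Gamma(TU_i)\oplus C^\infty(U_i,\mathfrak g)$ onto $A_{U_i}$. On $U_{ij}=U_i\cap U_j$ put $\widehat\alpha_i^{\,j}(\eta)=\eta\circ S_i^{-1}\circ S_j$ for scalar-valued forms $\eta$, and let $G^i_j$ be the matrix of $\Psi_i^{-1}\circ\Psi_j$ in the basis $(E_a)$. Assume that $L$ is orientable, the atlas being chosen accordingly: $\det G^i_j>0$ everywhere on $U_{ij}$, for all $i,j$. Let $\nabla$ be a connection on $A$ (a $C^\infty(M)$-linear right inverse of $\rho$), with connection form $\varpi\colon A\to L$ given by $a=\nabla_{\rho(a)}-\varpi(a)$, and let $\varpi_i^1,\dots,\varpi_i^n$ be the mixed basis over $U_i$, that is, the components in the basis $(E_a)$ of $\Psi_i^{-1}\circ\varpi\circ S_i$. Let $h$ be an inner metric: a symmetric $C^\infty(M)$-bilinear map $L\times L\to C^\infty(M)$ which is non-degenerate on every fibre of the vector bundle of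 which $L$ is the module of sections. Let $|h^i_{\mathrm{loc}}|$ be the absolute value of the determinant of the matrix $\big(h(\Psi_i(E_a),\Psi_i(E_b))\big)_{a,b}$ of functions on $U_i$. Then every $\sqrt{|h^i_{\mathrm{loc}}|}$ is smooth, and on $U_{ij}$, for all $i,j\in I$, $$\widehat\alpha_i^{\,j}\Big(\sqrt{|h^i_{\mathrm{loc}}|}\;\varpi_i^1\wedge\dots\wedge\varpi_i^n\Big)=\sqrt{|h^j_{\mathrm{loc}}|}\;\varpi_j^1\wedge\dots\wedge\varpi_j^n .$$ Consequently there is a unique global form $\omega_{h,\varpi}\in\Omega^n(A)$ whose local expression $\omega_{h,\varpi}\circ S_i$ over each $U_i$ is $$(-1)^n\sqrt{|h^i_{\mathrm{loc}}|}\;\varpi_i^1\wedge\dots\wedge\varpi_i^n .$$ It is of maximal inner degree $n$ and is a volume form for inner integration: its inner integral, that is, the coefficient of $\sqrt{|h^i_{\mathrm{loc}}|}\,\theta^1\wedge\dots\wedge\theta^n$ in its local expressions, is the constant function $1$. -/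

import Mathlib

open scoped Manifold ContDiff TensorProduct Topology
open TopologicalSpace

set_option linter.unusedSectionVars false

noncomputable section

section
variable (𝕜 : Type*) [RCLike 𝕜] (E : Type*) [NormedAddCommGroup E] [NormedSpace ℝ E]

/-- The smooth (in the real sense) `𝕜`-valued functions on a manifold `N` modelled on `E`,
as a subalgebra of all functions. -/
def smoothSubalgebra (N : Type*) [TopologicalSpace N] [ChartedSpace E N] :
    Subalgebra 𝕜 (N → 𝕜) where
  carrier := {f | ContMDiff 𝓘(ℝ, E) 𝓘(ℝ, 𝕜) ∞ f}
  mul_mem' {f g} hf hg := by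
    have h : ContDiff ℝ ∞ (fun p : 𝕜 × 𝕜 => p.1 * p.2) := contDiff_fst.mul contDiff_snd
    exact h.contMDiff.comp (hf.prodMk_space hg)
  add_mem' hf hg := hf.add hg
  algebraMap_mem' _ := contMDiff_const

/-- The algebra `C^∞(N)` of smooth `𝕜`-valued functions. -/
def Cinf (N : Type*) [TopologicalSpace N] [ChartedSpace E N] : Type _ :=
  ↥(smoothSubalgebra 𝕜 E N)

variable (N : Type*) [TopologicalSpace N] [ChartedSpace E N]

instance Cinf.instCommRing : CommRing (Cinf 𝕜 E N) :=
  inferInstanceAs (CommRing ↥(smoothSubalgebra 𝕜 E N))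

instance Cinf.instAlgebra : Algebra 𝕜 (Cinf 𝕜 E N) :=
  inferInstanceAs (Algebra 𝕜 ↥(smoothSubalgebra 𝕜 E N))

instance Cinf.instFunLike : FunLike (Cinf 𝕜 E N) N 𝕜 where
  coe f := f.1
  coe_injective _ _ h := Subtype.ext h

/-- Vector fields with coefficients in `𝕜`, as derivations of `C^∞(N)`. For a Hausdorff
finite-dimensional smooth manifold `N` these are the smooth sections of `TN` if `𝕜 = ℝ`, and those of
its complexification if `𝕜 = ℂ`. -/
abbrev VectorFields : Type _ :=
  Derivation 𝕜 (Cinf 𝕜 E N) (Cinf 𝕜 E N)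

end

namespace Cinf
variable {𝕜 : Type*} [RCLike 𝕜] {E : Type*} [NormedAddCommGroup E] [NormedSpace ℝ E]
  {N : Type*} [TopologicalSpace N] [ChartedSpace E N]

theorem ext {f g : Cinf 𝕜 E N} (h : ∀ x, f x = g x) : f = g := DFunLike.ext _ _ h

theorem contMDiff (f : Cinf 𝕜 E N) : ContMDiff 𝓘(ℝ, E) 𝓘(ℝ, 𝕜) ∞ f := f.2

/-- A smooth function as an element of `C^∞(N)`. -/
def mk (f : N → 𝕜) (hf : ContMDiff 𝓘(ℝ, E) 𝓘(ℝ, 𝕜) ∞ f) : Cinf 𝕜 E N := ⟨f, hf⟩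

@[simp] theorem mk_apply (f : N → 𝕜) (hf : ContMDiff 𝓘(ℝ, E) 𝓘(ℝ, 𝕜) ∞ f) (x : N) :
    mk f hf x = f x := rfl

@[simp] theorem add_apply (f g : Cinf 𝕜 E N) (x : N) : (f + g) x = f x + g x := rfl

@[simp] theorem sub_apply (f g : Cinf 𝕜 E N) (x : N) : (f - g) x = f x - g x := rfl

@[simp] theorem mul_apply (f g : Cinf 𝕜 E N) (x : N) : (f * g) x = f x * g x := rfl

@[simp] theorem smul_apply (c : 𝕜) (f : Cinf 𝕜 E N) (x : N) : (c • f) x = c * f x := rfl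

end Cinf

section Restriction
variable {𝕜 : Type*} [RCLike 𝕜] {E : Type*} [NormedAddCommGroup E] [NormedSpace ℝ E]
  {M : Type*} [TopologicalSpace M] [ChartedSpace E M]

/-- Restriction `C^∞(M) → C^∞(U)`. -/
def restrictFun (U : Opens M) : Cinf 𝕜 E M →ₐ[𝕜] Cinf 𝕜 E U where
  toFun f := Cinf.mk (fun x : U => f x) (f.contMDiff.comp contMDiff_subtype_val)
  map_one' := rfl
  map_mul' _ _ := rfl
  map_zero' := rfl
  map_add' _ _ := rfl
  commutes' _ := rfl

instance restrictAlgebra (U : Opens M) : Algebra (Cinf 𝕜 E M) (Cinf 𝕜 E U) :=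
  (restrictFun U).toAlgebra

instance restrictTower (U : Opens M) : IsScalarTower 𝕜 (Cinf 𝕜 E M) (Cinf 𝕜 E U) :=
  IsScalarTower.of_algebraMap_eq fun _ => rfl

@[simp] theorem algebraMap_restrict_apply (U : Opens M) (f : Cinf 𝕜 E M) (x : U) :
    algebraMap (Cinf 𝕜 E M) (Cinf 𝕜 E U) f x = f x := rfl

/-- Restriction `C^∞(U) → C^∞(V)` for `V ⊆ U`, as a morphism of `C^∞(M)`-algebras. -/
def restrictLE {V U : Opens M} (hVU : V ≤ U) : Cinf 𝕜 E U →ₐ[Cinf 𝕜 E M] Cinf 𝕜 E V where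
  toFun f := Cinf.mk (fun x : V => f (Set.inclusion hVU x))
    (f.contMDiff.comp (contMDiff_inclusion hVU))
  map_one' := rfl
  map_mul' _ _ := rfl
  map_zero' := rfl
  map_add' _ _ := rfl
  commutes' _ := rfl

end Restriction

section Extension
variable {𝕜 : Type*} [RCLike 𝕜] {E : Type*} [NormedAddCommGroup E] [NormedSpace ℝ E]
  {M : Type*} [TopologicalSpace M] [ChartedSpace E M]
 [FiniteDimensional ℝ E] [T2Space M] [IsManifold 𝓘(ℝ, E) ∞ M]

/-- Smooth cut-off functions. -/
theorem exists_cutoff (𝕜 : Type*) [RCLike 𝕜] (U : Opens M) (x : U) : ∃ χ : Cinf 𝕜 E M,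
    (∀ᶠ y in 𝓝 (x : M), χ y = 1) ∧ tsupport χ ⊆ U := by
  obtain ⟨f, -, hf⟩ := (SmoothBumpFunction.nhds_basis_tsupport (I := 𝓘(ℝ, E)) (x : M)).mem_iff.1
    (U.isOpen.mem_nhds x.2)
  refine ⟨Cinf.mk (fun y => ((f y : ℝ) : 𝕜)) ?_, ?_, ?_⟩
  · have : ContDiff ℝ ∞ (fun r : ℝ => (r : 𝕜)) := (RCLike.ofRealCLM (K := 𝕜)).contDiff
    exact this.contMDiff.comp f.contMDiff
  · filter_upwards [f.eventuallyEq_one] with y hy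
    simp [hy]
  · refine (closure_mono ?_).trans hf
    intro y hy
    simpa [Function.mem_support] using hy

/-- A cut-off supported in `U` times a smooth function on `U` extends by zero to `M`. -/
theorem exists_global_extension (U : Opens M) (χ : Cinf 𝕜 E M) (hχ : tsupport χ ⊆ U)
    (f : Cinf 𝕜 E U) : ∃ F : Cinf 𝕜 E M, ∀ y : U, F y = χ y * f y := by
  classical
  refine ⟨Cinf.mk (fun y => χ y * (if hy : y ∈ U then f ⟨y, hy⟩ else 0)) ?_, ?_⟩
  · intro y
    by_cases hy : y ∈ tsupport χ
    · have hyU : y ∈ U := hχ hy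
      have h2 := (algebraMap (Cinf 𝕜 E M) (Cinf 𝕜 E U) χ * f).contMDiff ⟨y, hyU⟩
      have h3 := contMDiffAt_subtype_iff (I := 𝓘(ℝ, E)) (I' := 𝓘(ℝ, 𝕜)) (n := ∞)
        (f := fun y => χ y * (if hy : y ∈ U then f ⟨y, hy⟩ else 0)) (U := U) (x := ⟨y, hyU⟩)
      refine h3.1 ?_
      convert h2 using 1
      ext z
      simp
    · have : ∀ᶠ z in 𝓝 y, z ∉ tsupport χ := (isClosed_tsupport _).isOpen_compl.mem_nhds hy
      refine (contMDiffAt_const (c := (0 : 𝕜))).congr_of_eventuallyEq ?_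
      filter_upwards [this] with z hz
      simp [image_eq_zero_of_notMem_tsupport hz]
  · intro y
    simp

/-- Every smooth function on `U` agrees near a given point with the restriction of a global one. -/
theorem exists_local_extension (U : Opens M) (x : U) (f : Cinf 𝕜 E U) :
    ∃ F : Cinf 𝕜 E M, ∀ᶠ y : U in 𝓝 x, F (y : M) = f y := by
  obtain ⟨χ, h1, h2⟩ := exists_cutoff (E := E) 𝕜 U x
  obtain ⟨F, hF⟩ := exists_global_extension U χ h2 f
  refine ⟨F, ?_⟩
  filter_upwards [continuous_subtype_val.continuousAt.eventually h1] with y hy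
  rw [hF, hy, one_mul]

variable {U : Opens M}

/-- Derivations are local operators. -/
theorem derivation_congr (δ : Derivation 𝕜 (Cinf 𝕜 E M) (Cinf 𝕜 E U)) (x : U)
    {F G : Cinf 𝕜 E M} (h : ∀ᶠ y : U in 𝓝 x, F (y : M) = G y) : δ F x = δ G x := by
  obtain ⟨W, hW, hWo, hxW⟩ := eventually_nhds_iff.1 h
  obtain ⟨W', hW'o, rfl⟩ := isOpen_induced_iff.1 hWo
  obtain ⟨χ, h1, h2⟩ := exists_cutoff (E := E) 𝕜 (⟨W' ∩ U, hW'o.inter U.isOpen⟩ : Opens M)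
    ⟨(x : M), hxW, x.2⟩
  have h0 : χ * (F - G) = 0 := by
    refine Cinf.ext fun y => ?_
    by_cases hy : y ∈ tsupport χ
    · obtain ⟨hy1, hy2⟩ := h2 hy
      have := hW ⟨y, hy2⟩ hy1
      simp only [] at this
      simp only [Cinf.mul_apply, Cinf.sub_apply, this, sub_self, mul_zero]
      rfl
    · simp only [Cinf.mul_apply, image_eq_zero_of_notMem_tsupport hy, zero_mul]
      rfl
  have h3 := congrArg (fun f => f x) (congrArg δ h0)
  have h4 : χ (x : M) = 1 := h1.self_of_nhds
  have h5 : F (x : M) = G x := h.self_of_nhds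
  simp only [Derivation.leibniz, map_zero, Algebra.smul_def, Cinf.add_apply, Cinf.mul_apply,
    algebraMap_restrict_apply, h4, h5, Cinf.sub_apply, sub_self, zero_mul, one_mul, add_zero,
    map_sub] at h3
  exact sub_eq_zero.1 h3

/-- The function `x ↦ δ(F)(x)`, where `F` is any global function agreeing with `f` near `x`. -/
def derivationExtendFun (δ : Derivation 𝕜 (Cinf 𝕜 E M) (Cinf 𝕜 E U)) (f : Cinf 𝕜 E U) (x : U) : 𝕜 :=
  δ (exists_local_extension U x f).choose x

theorem derivationExtendFun_eq (δ : Derivation 𝕜 (Cinf 𝕜 E M) (Cinf 𝕜 E U)) {f : Cinf 𝕜 E U}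
    {x : U} {F : Cinf 𝕜 E M} (hF : ∀ᶠ y : U in 𝓝 x, F (y : M) = f y) :
    derivationExtendFun δ f x = δ F x :=
  derivation_congr δ x <| by
    filter_upwards [(exists_local_extension U x f).choose_spec, hF] with y h1 h2
    rw [h1, h2]

theorem derivationExtendFun_contMDiff (δ : Derivation 𝕜 (Cinf 𝕜 E M) (Cinf 𝕜 E U))
    (f : Cinf 𝕜 E U) : ContMDiff 𝓘(ℝ, E) 𝓘(ℝ, 𝕜) ∞ (derivationExtendFun δ f) := by
  intro x
  obtain ⟨F, hF⟩ := exists_local_extension U x f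
  refine ((δ F).contMDiff x).congr_of_eventuallyEq ?_
  filter_upwards [eventually_eventually_nhds.2 hF] with z hz
  exact derivationExtendFun_eq δ hz

/-- A derivation `C^∞(M) → C^∞(U)`, that is, a vector field along the inclusion of `U`, as
a derivation of `C^∞(U)`. -/
def derivationExtend (δ : Derivation 𝕜 (Cinf 𝕜 E M) (Cinf 𝕜 E U)) : VectorFields 𝕜 E U :=
  Derivation.mk'
    { toFun := fun f => Cinf.mk (derivationExtendFun δ f) (derivationExtendFun_contMDiff δ f)
      map_add' := fun f g => by
        refine Cinf.ext fun x => ?_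
        obtain ⟨F, hF⟩ := exists_local_extension U x f
        obtain ⟨G, hG⟩ := exists_local_extension U x g
        have h : ∀ᶠ y : U in 𝓝 x, (F + G) (y : M) = (f + g) y := by
          filter_upwards [hF, hG] with y h1 h2
          rw [Cinf.add_apply, Cinf.add_apply, h1, h2]
        change derivationExtendFun δ (f + g) x =
          derivationExtendFun δ f x + derivationExtendFun δ g x
        rw [derivationExtendFun_eq δ h, derivationExtendFun_eq δ hF, derivationExtendFun_eq δ hG,
          map_add, Cinf.add_apply]
      map_smul' := fun c f => by
        refine Cinf.ext fun x => ?_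
        obtain ⟨F, hF⟩ := exists_local_extension U x f
        have h : ∀ᶠ y : U in 𝓝 x, (c • F) (y : M) = (c • f) y := by
          filter_upwards [hF] with y h1
          rw [Cinf.smul_apply, Cinf.smul_apply, h1]
        change derivationExtendFun δ (c • f) x = c * derivationExtendFun δ f x
        rw [derivationExtendFun_eq δ h, derivationExtendFun_eq δ hF, Derivation.map_smul,
          Cinf.smul_apply] }
    (fun f g => by
      refine Cinf.ext fun x => ?_
      obtain ⟨F, hF⟩ := exists_local_extension U x f
      obtain ⟨G, hG⟩ := exists_local_extension U x g
      have h : ∀ᶠ y : U in 𝓝 x, (F * G) (y : M) = (f * g) y := by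
        filter_upwards [hF, hG] with y h1 h2
        rw [Cinf.mul_apply, Cinf.mul_apply, h1, h2]
      change derivationExtendFun δ (f * g) x =
        f x * derivationExtendFun δ g x + g x * derivationExtendFun δ f x
      rw [derivationExtendFun_eq δ h, derivationExtendFun_eq δ hF, derivationExtendFun_eq δ hG,
        Derivation.leibniz, Algebra.smul_def, Algebra.smul_def, Cinf.add_apply, Cinf.mul_apply,
        Cinf.mul_apply, algebraMap_restrict_apply, algebraMap_restrict_apply, hF.self_of_nhds,
        hG.self_of_nhds])

theorem derivationExtend_apply (δ : Derivation 𝕜 (Cinf 𝕜 E M) (Cinf 𝕜 E U)) (f : Cinf 𝕜 E U)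
    (x : U) (F : Cinf 𝕜 E M) (hF : ∀ᶠ y : U in 𝓝 x, F (y : M) = f y) :
    derivationExtend δ f x = δ F x :=
  derivationExtendFun_eq δ hF

/-- `derivationExtend` as a `C^∞(U)`-linear map. -/
def derivationExtendₗ (U : Opens M) :
    Derivation 𝕜 (Cinf 𝕜 E M) (Cinf 𝕜 E U) →ₗ[Cinf 𝕜 E U] VectorFields 𝕜 E U where
  toFun := derivationExtend
  map_add' _ _ := rfl
  map_smul' _ _ := Derivation.ext fun _ => Cinf.ext fun _ => rfl

/-- Restriction of vector fields from `M` to `U`. -/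
def restrictVF (U : Opens M) : VectorFields 𝕜 E M →ₗ[Cinf 𝕜 E M] VectorFields 𝕜 E U :=
  ((derivationExtendₗ U).restrictScalars (Cinf 𝕜 E M)).comp
    (Algebra.linearMap (Cinf 𝕜 E M) (Cinf 𝕜 E U)).compDer

/-- `X|_U (f|_U) = (X f)|_U`. -/
theorem restrictVF_algebraMap (X : VectorFields 𝕜 E M) (f : Cinf 𝕜 E M) :
    restrictVF U X (algebraMap _ _ f) = algebraMap _ (Cinf 𝕜 E U) (X f) :=
  Cinf.ext fun x => derivationExtend_apply _ _ x f (.of_forall fun _ => rfl)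

/-- Restriction of vector fields from `U` to `V ⊆ U`. -/
def restrictVFLE {V U : Opens M} (hVU : V ≤ U) (X : VectorFields 𝕜 E U) : VectorFields 𝕜 E V :=
  derivationExtend
    ((restrictLE hVU).toLinearMap.compDer (X.compAlgebraMap (Cinf 𝕜 E M)))

/-- A derivation of `C^∞(U)` is determined by its values on restrictions of global functions. -/
theorem derivation_eq_of_eventuallyEq (D : VectorFields 𝕜 E U) (x : U) (f : Cinf 𝕜 E U)
    (F : Cinf 𝕜 E M) (hF : ∀ᶠ y : U in 𝓝 x, F (y : M) = f y) :
    D f x = D (algebraMap _ _ F) x := by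
  obtain ⟨W, hW, hWo, hxW⟩ := eventually_nhds_iff.1 hF
  obtain ⟨W', hW'o, rfl⟩ := isOpen_induced_iff.1 hWo
  obtain ⟨χ, h1, h2⟩ := exists_cutoff (E := E) 𝕜 (⟨W' ∩ U, hW'o.inter U.isOpen⟩ : Opens M)
    ⟨(x : M), hxW, x.2⟩
  have h0 : algebraMap _ (Cinf 𝕜 E U) χ * (f - algebraMap _ _ F) = 0 := by
    refine Cinf.ext fun y => ?_
    by_cases hy : (y : M) ∈ tsupport χ
    · have := hW y (h2 hy).1
      simp only [Cinf.mul_apply, Cinf.sub_apply, algebraMap_restrict_apply, this, sub_self,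
        mul_zero]
      rfl
    · simp only [Cinf.mul_apply, algebraMap_restrict_apply,
        image_eq_zero_of_notMem_tsupport hy, zero_mul]
      rfl
  have h3 := congrArg (fun f => f x) (congrArg D h0)
  have h4 : χ (x : M) = 1 := h1.self_of_nhds
  have h5 : F (x : M) = f x := hF.self_of_nhds
  simp only [Derivation.leibniz, map_zero, smul_eq_mul, Cinf.add_apply, Cinf.mul_apply,
    algebraMap_restrict_apply, h4, h5, Cinf.sub_apply, sub_self, zero_mul, one_mul, add_zero,
    map_sub] at h3
  exact sub_eq_zero.1 h3

/-- `X|_V (f|_V) = (X f)|_V`. -/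
theorem restrictVFLE_restrictLE {V U : Opens M} (hVU : V ≤ U) (X : VectorFields 𝕜 E U)
    (f : Cinf 𝕜 E U) : restrictVFLE hVU X (restrictLE hVU f) = restrictLE hVU (X f) := by
  refine Cinf.ext fun x => ?_
  obtain ⟨F, hF⟩ := exists_local_extension U (Set.inclusion hVU x) f
  refine (derivationExtend_apply _ _ x F ?_).trans
    (derivation_eq_of_eventuallyEq X (Set.inclusion hVU x) f F hF).symm
  exact (continuous_inclusion hVU).continuousAt.eventually hF

end Extension

section Algebroid

variable (𝕜 : Type*) [RCLike 𝕜] (E : Type*) [NormedAddCommGroup E] [NormedSpace ℝ E]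
  (M : Type*) [TopologicalSpace M] [ChartedSpace E M]

/-- A Lie algebroid over `M`: a finitely generated projective `C^∞(M)`-module `A` with a Lie bracket
and a `C^∞(M)`-linear Lie morphism (the anchor) to vector fields that satisfies the Leibniz rule. -/
structure LieAlgebroid (A : Type*) [LieRing A] [Module (Cinf 𝕜 E M) A] where
  finite : Module.Finite (Cinf 𝕜 E M) A
  projective : Module.Projective (Cinf 𝕜 E M) A
  anchor : A →ₗ[Cinf 𝕜 E M] VectorFields 𝕜 E M
  anchor_lie : ∀ a b : A, anchor ⁅a, b⁆ = ⁅anchor a, anchor b⁆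
  leibniz : ∀ (a b : A) (f : Cinf 𝕜 E M), ⁅a, f • b⁆ = f • ⁅a, b⁆ + anchor a f • b

end Algebroid

namespace LieAlgebroid

variable {𝕜 : Type*} [RCLike 𝕜] {E : Type*} [NormedAddCommGroup E] [NormedSpace ℝ E]
  [FiniteDimensional ℝ E] {M : Type*} [TopologicalSpace M] [ChartedSpace E M]
  [T2Space M] [IsManifold 𝓘(ℝ, E) ∞ M]
  {A : Type*} [LieRing A] [Module (Cinf 𝕜 E M) A] (𝔸 : LieAlgebroid 𝕜 E M A)

/-- A Lie algebroid is transitive if its anchor is surjective. -/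
def IsTransitive : Prop := Function.Surjective 𝔸.anchor

/-- The kernel `L` of the anchor. -/
abbrev kernel : Submodule (Cinf 𝕜 E M) A := LinearMap.ker 𝔸.anchor

/-- The module of sections over `U` is `A_U = C^∞(U) ⊗ A`, the tensor product being over `C^∞(M)`;
as `A` is finitely generated projective, this is the module of smooth sections over `U` of the vector
bundle whose module of global sections is `A`. This is the restriction map `A_U → A_V`. -/
def restrictSections {V U : Opens M} (hVU : V ≤ U) :
    Cinf 𝕜 E U ⊗[Cinf 𝕜 E M] A →ₗ[Cinf 𝕜 E M] Cinf 𝕜 E V ⊗[Cinf 𝕜 E M] A :=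
  (restrictLE hVU).toLinearMap.rTensor A

/-- The anchor of `A_U`: `f ⊗ a ↦ f ρ(a)|_U`. -/
def anchorOn (U : Opens M) : Cinf 𝕜 E U ⊗[Cinf 𝕜 E M] A →ₗ[Cinf 𝕜 E U] VectorFields 𝕜 E U :=
  LinearMap.liftBaseChange (Cinf 𝕜 E U) ((restrictVF U).comp 𝔸.anchor)

theorem anchorOn_tmul (U : Opens M) (f : Cinf 𝕜 E U) (a : A) :
    𝔸.anchorOn U (f ⊗ₜ a) = f • restrictVF U (𝔸.anchor a) := by
  simp [anchorOn]

theorem smul_lie (f : Cinf 𝕜 E M) (a b : A) : ⁅f • a, b⁆ = f • ⁅a, b⁆ - 𝔸.anchor b f • a := by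
  rw [← lie_skew, 𝔸.leibniz, ← lie_skew a b]
  simp only [smul_neg]
  abel

/-- The operator `g ⊗ b ↦ ρ(a)(g) ⊗ b + g ⊗ [a, b]` on `A_U`. -/
def adOn (U : Opens M) (a : A) :
    Cinf 𝕜 E U ⊗[Cinf 𝕜 E M] A →+ Cinf 𝕜 E U ⊗[Cinf 𝕜 E M] A :=
  TensorProduct.liftAddHom
    (AddMonoidHom.mk' (fun g => AddMonoidHom.mk'
        (fun b => (restrictVF U (𝔸.anchor a) g) ⊗ₜ[Cinf 𝕜 E M] b + g ⊗ₜ[Cinf 𝕜 E M] ⁅a, b⁆)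
        (fun b c => by simp only [lie_add, TensorProduct.tmul_add]; abel))
      (fun g h => by
        ext b
        simp only [AddMonoidHom.mk'_apply, AddMonoidHom.add_apply, map_add,
          TensorProduct.add_tmul]
        abel))
    (fun r g b => by
      simp only [AddMonoidHom.mk'_apply, 𝔸.leibniz, TensorProduct.tmul_add, Algebra.smul_def r g,
        Derivation.leibniz, restrictVF_algebraMap, TensorProduct.add_tmul, smul_eq_mul]
      rw [mul_comm g, ← Algebra.smul_def, ← Algebra.smul_def, ← Algebra.smul_def]
      simp only [TensorProduct.smul_tmul]
      abel)

theorem adOn_tmul (U : Opens M) (a b : A) (g : Cinf 𝕜 E U) :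
    𝔸.adOn U a (g ⊗ₜ b) = (restrictVF U (𝔸.anchor a) g) ⊗ₜ b + g ⊗ₜ ⁅a, b⁆ := rfl

theorem adOn_smul (U : Opens M) (r : Cinf 𝕜 E M) (a : A)
    (t : Cinf 𝕜 E U ⊗[Cinf 𝕜 E M] A) :
    𝔸.adOn U (r • a) t =
      r • 𝔸.adOn U a t - 𝔸.anchorOn U t (algebraMap _ _ r) ⊗ₜ[Cinf 𝕜 E M] a := by
  induction t with
  | zero => simp
  | add x y hx hy =>
    simp only [map_add, hx, hy, smul_add, Derivation.add_apply, TensorProduct.add_tmul]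
    abel
  | tmul g b =>
    simp only [adOn_tmul, anchorOn_tmul, 𝔸.smul_lie, map_smul, Derivation.smul_apply,
      restrictVF_algebraMap, smul_add, TensorProduct.tmul_sub, smul_eq_mul]
    rw [mul_comm g, ← Algebra.smul_def]
    simp only [TensorProduct.smul_tmul', TensorProduct.tmul_smul]
    abel

/-- The Lie bracket of `A_U`, the extension of that of `A` by the Leibniz rule:
`[f ⊗ a, g ⊗ b] = fg ⊗ [a, b] + f ρ(a)(g) ⊗ b - g ρ(b)(f) ⊗ a`. -/
def bracketOn (U : Opens M) :
    Cinf 𝕜 E U ⊗[Cinf 𝕜 E M] A →+ Cinf 𝕜 E U ⊗[Cinf 𝕜 E M] A →+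
      Cinf 𝕜 E U ⊗[Cinf 𝕜 E M] A :=
  TensorProduct.liftAddHom
    (AddMonoidHom.mk' (fun f => AddMonoidHom.mk'
        (fun a => AddMonoidHom.mk'
          (fun t => f • 𝔸.adOn U a t - (𝔸.anchorOn U t f) ⊗ₜ[Cinf 𝕜 E M] a)
          (fun s t => by
            simp only [map_add, smul_add, Derivation.add_apply, TensorProduct.add_tmul]
            abel))
        (fun a b => by
          ext t
          induction t with
          | zero => simp
          | add x y hx hy => rw [map_add, hx, hy, map_add]
          | tmul g c =>
            simp only [AddMonoidHom.mk'_apply, AddMonoidHom.add_apply, adOn_tmul, map_add,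
              Derivation.add_apply, TensorProduct.add_tmul, add_lie, TensorProduct.tmul_add,
              smul_add]
            abel))
      (fun f g => by
        ext a t
        simp only [AddMonoidHom.mk'_apply, AddMonoidHom.add_apply, map_add, add_smul,
          TensorProduct.add_tmul]
        abel))
    (fun r f a => by
      ext t
      simp only [AddMonoidHom.mk'_apply, adOn_smul, Algebra.smul_def r f, Derivation.leibniz,
        TensorProduct.add_tmul, smul_sub, smul_eq_mul]
      rw [← Algebra.smul_def, smul_assoc, smul_comm r f,
        TensorProduct.smul_tmul', ← TensorProduct.smul_tmul, Algebra.smul_def r]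
      simp only [smul_eq_mul]
      abel)

theorem bracketOn_tmul (U : Opens M) (f g : Cinf 𝕜 E U) (a b : A) :
    𝔸.bracketOn U (f ⊗ₜ a) (g ⊗ₜ b) = (f * g) ⊗ₜ[Cinf 𝕜 E M] ⁅a, b⁆
      + (f * restrictVF U (𝔸.anchor a) g) ⊗ₜ[Cinf 𝕜 E M] b
      - (g * restrictVF U (𝔸.anchor b) f) ⊗ₜ[Cinf 𝕜 E M] a := by
  have : 𝔸.bracketOn U (f ⊗ₜ a) (g ⊗ₜ b) =
    f • 𝔸.adOn U a (g ⊗ₜ b) - (𝔸.anchorOn U (g ⊗ₜ b) f) ⊗ₜ[Cinf 𝕜 E M] a := rfl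
  rw [this, adOn_tmul, anchorOn_tmul, smul_add, TensorProduct.smul_tmul',
    TensorProduct.smul_tmul', Derivation.smul_apply]
  simp only [smul_eq_mul]
  abel

/-- The module `L_U` of sections over `U` of the kernel, that is, the kernel of the anchor of `A_U`. -/
abbrev kernelOn (U : Opens M) : Submodule (Cinf 𝕜 E U) (Cinf 𝕜 E U ⊗[Cinf 𝕜 E M] A) :=
  LinearMap.ker (𝔸.anchorOn U)

/-- Restriction to `U` of a global section of the kernel. -/
def restrictKernel (U : Opens M) (ℓ : 𝔸.kernel) : 𝔸.kernelOn U :=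
  ⟨1 ⊗ₜ (ℓ : A), by rw [LinearMap.mem_ker, anchorOn_tmul, LinearMap.mem_ker.1 ℓ.2]; simp⟩

/-- A connection: a `C^∞(M)`-linear splitting of the anchor. -/
structure Connection where
  toLinearMap : VectorFields 𝕜 E M →ₗ[Cinf 𝕜 E M] A
  anchor_comp : ∀ X, 𝔸.anchor (toLinearMap X) = X

namespace Connection
variable {𝔸} (conn : 𝔸.Connection)

/-- The connection form `A → L`, determined by `a = ∇_{ρ(a)} - form(a)`. -/
def form : A →ₗ[Cinf 𝕜 E M] 𝔸.kernel :=
  LinearMap.codRestrict 𝔸.kernel (conn.toLinearMap.comp 𝔸.anchor - LinearMap.id) fun a => by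
    simp [LinearMap.mem_ker, conn.anchor_comp]

theorem form_spec (a : A) : a = conn.toLinearMap (𝔸.anchor a) - (conn.form a : A) := by
  simp [form]

theorem form_kernel (ℓ : 𝔸.kernel) : conn.form (ℓ : A) = -ℓ := by
  ext
  simp [form, LinearMap.mem_ker.1 ℓ.2]

/-- The connection form over `U`, extended `C^∞(U)`-linearly to `A_U → L_U`. -/
def formOn (U : Opens M) : Cinf 𝕜 E U ⊗[Cinf 𝕜 E M] A →ₗ[Cinf 𝕜 E U] 𝔸.kernelOn U :=
  LinearMap.codRestrict (𝔸.kernelOn U)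
    ((𝔸.kernel.subtype.comp conn.form).baseChange (Cinf 𝕜 E U)) fun t => by
      rw [LinearMap.mem_ker]
      induction t with
      | zero => simp
      | add x y hx hy => rw [map_add, map_add, hx, hy, add_zero]
      | tmul f a =>
        rw [LinearMap.baseChange_tmul, anchorOn_tmul]
        simp only [LinearMap.comp_apply, Submodule.subtype_apply, LinearMap.mem_ker.1 (conn.form a).2,
          map_zero, smul_zero]

/-- The metric `(a, b) ↦ h(form a, form b)` on `A`; its restriction to the kernel is `h`. -/
def pullbackMetric (h : LinearMap.BilinForm (Cinf 𝕜 E M) 𝔸.kernel) :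
    LinearMap.BilinForm (Cinf 𝕜 E M) A :=
  h.compl₁₂ conn.form conn.form

/-- The metric `h` over `U`, as a `C^∞(U)`-bilinear form on `L_U`. It is the unique one which takes
the value `h(ℓ, ℓ')|_U` on restrictions of global sections `ℓ`, `ℓ'` of the kernel (see
`metricOn_restrictKernel`), so that it does not depend on the connection. It is obtained by restricting
the extension to `A_U` of the metric `h(form ·, form ·)` on `A`. -/
def metricOn (h : LinearMap.BilinForm (Cinf 𝕜 E M) 𝔸.kernel) (U : Opens M) :
    LinearMap.BilinForm (Cinf 𝕜 E U) (𝔸.kernelOn U) :=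
  ((conn.pullbackMetric h).baseChange (Cinf 𝕜 E U)).restrict (𝔸.kernelOn U)

theorem metricOn_restrictKernel (h : LinearMap.BilinForm (Cinf 𝕜 E M) 𝔸.kernel) (U : Opens M)
    (ℓ ℓ' : 𝔸.kernel) :
    conn.metricOn h U (𝔸.restrictKernel U ℓ) (𝔸.restrictKernel U ℓ') =
      algebraMap _ _ (h ℓ ℓ') := by
  simp [metricOn, pullbackMetric, restrictKernel, form_kernel, Algebra.smul_def]

end Connection

/-- Nondegeneracy of `h` as a metric on the vector bundle of which `L` is the module of sections: on
every fibre `L / m_x L`, where `m_x` is the ideal of the functions vanishing at `x`, the bilinear form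
`h_x` has no kernel. -/
def FiberwiseNondegenerate (h : LinearMap.BilinForm (Cinf 𝕜 E M) 𝔸.kernel) : Prop :=
  ∀ (x : M) (ℓ : 𝔸.kernel), (∀ ℓ', h ℓ ℓ' x = 0) →
    ℓ ∈ (Ideal.span {f : Cinf 𝕜 E M | f x = 0}) • (⊤ : Submodule (Cinf 𝕜 E M) 𝔸.kernel)

variable (𝔤 : Type*) [LieRing 𝔤] [LieAlgebra 𝕜 𝔤]

/-- A local trivialization `(U, Ψ, ∇⁰)` of the Lie algebroid with model Lie algebra `𝔤`. The
bundle maps `Ψ : U × 𝔤 ≃ L|_U` and `∇⁰ : TU → A|_U` are given by the maps that they induce on smooth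
sections over the open subsets `V` of `U`, compatibly with restriction; the smooth sections of `V × 𝔤`
are `C^∞(V) ⊗ 𝔤`. -/
structure LocalTrivialization (U : Opens M) where
  psi : ∀ V : Opens M, V ≤ U → (Cinf 𝕜 E V ⊗[𝕜] 𝔤) ≃ₗ[Cinf 𝕜 E V] 𝔸.kernelOn V
  nabla : ∀ V : Opens M, V ≤ U →
    VectorFields 𝕜 E V →ₗ[Cinf 𝕜 E V] Cinf 𝕜 E V ⊗[Cinf 𝕜 E M] A
  psi_restrict : ∀ (V : Opens M) (hV : V ≤ U) (W : Opens M) (hW : W ≤ V)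
    (γ : Cinf 𝕜 E V ⊗[𝕜] 𝔤),
    restrictSections hW (psi V hV γ : Cinf 𝕜 E V ⊗[Cinf 𝕜 E M] A) =
      psi W (hW.trans hV) (((restrictLE hW).restrictScalars 𝕜).toLinearMap.rTensor 𝔤 γ)
  nabla_restrict : ∀ (V : Opens M) (hV : V ≤ U) (W : Opens M) (hW : W ≤ V)
    (X : VectorFields 𝕜 E V),
    restrictSections hW (nabla V hV X) = nabla W (hW.trans hV) (restrictVFLE hW X)
  /-- `[Ψ(γ), Ψ(η)] = Ψ([γ, η])`. -/
  psi_lie : ∀ (V : Opens M) (hV : V ≤ U) (γ η : Cinf 𝕜 E V ⊗[𝕜] 𝔤),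
    𝔸.bracketOn V (psi V hV γ) (psi V hV η) = psi V hV ⁅γ, η⁆
  /-- `[∇⁰_X, ∇⁰_Y] = ∇⁰_{[X, Y]}`. -/
  nabla_lie : ∀ (V : Opens M) (hV : V ≤ U) (X Y : VectorFields 𝕜 E V),
    𝔸.bracketOn V (nabla V hV X) (nabla V hV Y) = nabla V hV ⁅X, Y⁆
  /-- `ρ(∇⁰_X) = X`. -/
  anchor_nabla : ∀ (V : Opens M) (hV : V ≤ U) (X : VectorFields 𝕜 E V),
    𝔸.anchorOn V (nabla V hV X) = X
  /-- `[∇⁰_X, Ψ(γ)] = Ψ(X · γ)`. -/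
  nabla_psi_lie : ∀ (V : Opens M) (hV : V ≤ U) (X : VectorFields 𝕜 E V)
    (γ : Cinf 𝕜 E V ⊗[𝕜] 𝔤),
    𝔸.bracketOn V (nabla V hV X) (psi V hV γ) = psi V hV (X.toLinearMap.rTensor 𝔤 γ)


variable (𝕜 E) in
/-- The trivial Lie algebroid over `U`: its elements are the `X ⊕ γ`. -/
abbrev TLA (U : Opens M) : Type _ := VectorFields 𝕜 E U × (Cinf 𝕜 E U ⊗[𝕜] 𝔤)

variable (𝕜 E) in
/-- `n`-forms on the trivial Lie algebroid over `U` with values in `C^∞(U)`. -/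
abbrev LocalForm (n : ℕ) (U : Opens M) : Type _ :=
  (TLA 𝕜 E 𝔤 U) [⋀^Fin n]→ₗ[Cinf 𝕜 E U] Cinf 𝕜 E U

namespace LocalTrivialization
variable {𝔸 𝔤} {U : Opens M} (T : 𝔸.LocalTrivialization 𝔤 U)

/-- Restriction of a local trivialization to a smaller open set. -/
def restrict {V : Opens M} (hVU : V ≤ U) : 𝔸.LocalTrivialization 𝔤 V where
  psi W hW := T.psi W (hW.trans hVU)
  nabla W hW := T.nabla W (hW.trans hVU)
  psi_restrict W hW := T.psi_restrict W (hW.trans hVU)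
  nabla_restrict W hW := T.nabla_restrict W (hW.trans hVU)
  psi_lie W hW := T.psi_lie W (hW.trans hVU)
  nabla_lie W hW := T.nabla_lie W (hW.trans hVU)
  anchor_nabla W hW := T.anchor_nabla W (hW.trans hVU)
  nabla_psi_lie W hW := T.nabla_psi_lie W (hW.trans hVU)

/-- `Ψ` over `U` itself. -/
def Psi : (Cinf 𝕜 E U ⊗[𝕜] 𝔤) ≃ₗ[Cinf 𝕜 E U] 𝔸.kernelOn U := T.psi U le_rfl

/-- `∇⁰` over `U` itself. -/
def Nabla : VectorFields 𝕜 E U →ₗ[Cinf 𝕜 E U] Cinf 𝕜 E U ⊗[Cinf 𝕜 E M] A := T.nabla U le_rfl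

/-- The isomorphism `S(X ⊕ γ) = ∇⁰_X + Ψ(γ)`. -/
def S : TLA 𝕜 E 𝔤 U ≃ₗ[Cinf 𝕜 E U] Cinf 𝕜 E U ⊗[Cinf 𝕜 E M] A :=
  have hN : ∀ X, 𝔸.anchorOn U (T.Nabla X) = X := T.anchor_nabla U le_rfl
  { T.Nabla.coprod ((𝔸.kernelOn U).subtype.comp T.Psi.toLinearMap) with
    invFun := fun t =>
      (𝔸.anchorOn U t, T.Psi.symm ⟨t - T.Nabla (𝔸.anchorOn U t), by
        rw [LinearMap.mem_ker, map_sub, hN, sub_self]⟩)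
    left_inv := fun p => by
      have h : 𝔸.anchorOn U (T.Nabla p.1 + (T.Psi p.2 : Cinf 𝕜 E U ⊗[Cinf 𝕜 E M] A)) = p.1 := by
        rw [map_add, hN, LinearMap.mem_ker.1 (T.Psi p.2).2, add_zero]
      refine Prod.ext h ?_
      refine (LinearEquiv.symm_apply_eq _).2 (Subtype.ext ?_)
      change T.Nabla p.1 + (T.Psi p.2 : Cinf 𝕜 E U ⊗[Cinf 𝕜 E M] A) - T.Nabla (𝔸.anchorOn U
        (T.Nabla p.1 + (T.Psi p.2 : Cinf 𝕜 E U ⊗[Cinf 𝕜 E M] A))) = _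
      rw [h, add_sub_cancel_left]
    right_inv := fun t => by
      change T.Nabla (𝔸.anchorOn U t) + ((T.Psi (T.Psi.symm _) : 𝔸.kernelOn U) :
        Cinf 𝕜 E U ⊗[Cinf 𝕜 E M] A) = t
      rw [LinearEquiv.apply_symm_apply, add_sub_cancel] }

theorem S_apply (X : VectorFields 𝕜 E U) (γ : Cinf 𝕜 E U ⊗[𝕜] 𝔤) :
    T.S (X, γ) = T.Nabla X + (T.Psi γ : Cinf 𝕜 E U ⊗[Cinf 𝕜 E M] A) := rfl

/-- The change of trivialization `η ↦ η ∘ (S⁻¹ ∘ S')` of scalar forms: it takes local expressions in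
`T` to local expressions in `T'`. -/
def transport {n : ℕ} (T T' : 𝔸.LocalTrivialization 𝔤 U) (η : LocalForm 𝕜 E 𝔤 n U) :
    LocalForm 𝕜 E 𝔤 n U :=
  η.compLinearMap (T'.S.trans T.S.symm).toLinearMap

/-- The transition map `Ψ⁻¹ ∘ Ψ'`. -/
def alpha (T T' : 𝔸.LocalTrivialization 𝔤 U) :
    (Cinf 𝕜 E U ⊗[𝕜] 𝔤) ≃ₗ[Cinf 𝕜 E U] (Cinf 𝕜 E U ⊗[𝕜] 𝔤) :=
  T'.Psi.trans T.Psi.symm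

variable {n : ℕ} (e : Module.Basis (Fin n) 𝕜 𝔤)

variable (E U) in
/-- The basis of the sections of `U × 𝔤` given by the constant sections with values in a basis of
`𝔤`. -/
def sectionBasis : Module.Basis (Fin n) (Cinf 𝕜 E U) (Cinf 𝕜 E U ⊗[𝕜] 𝔤) :=
  e.baseChange (Cinf 𝕜 E U)

/-- The matrix `G` of `α = Ψ⁻¹ ∘ Ψ'`: `α(e_a) = ∑ b, G b a • e_b`. -/
def transitionMatrix (T T' : 𝔸.LocalTrivialization 𝔤 U) : Matrix (Fin n) (Fin n) (Cinf 𝕜 E U) :=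
  LinearMap.toMatrix (sectionBasis E U e) (sectionBasis E U e) (T.alpha T').toLinearMap

/-- The local expression `Ψ⁻¹ ∘ form ∘ S` of the connection form. -/
def localConnectionForm (conn : 𝔸.Connection) :
    TLA 𝕜 E 𝔤 U →ₗ[Cinf 𝕜 E U] (Cinf 𝕜 E U ⊗[𝕜] 𝔤) :=
  T.Psi.symm.toLinearMap.comp ((conn.formOn U).comp T.S.toLinearMap)

/-- The `a`-th element of the mixed basis: the `a`-th component of the local connection form. -/
def mixedBasis (conn : 𝔸.Connection) (a : Fin n) : TLA 𝕜 E 𝔤 U →ₗ[Cinf 𝕜 E U] Cinf 𝕜 E U :=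
  ((sectionBasis E U e).coord a).comp (T.localConnectionForm conn)

/-- The exterior product of the `n` elements of the mixed basis, in their order:
`(Z_1, …, Z_n) ↦ det (ϖ^a(Z_b))`, where `ϖ^a` is the `a`-th element. -/
def mixedTopForm (conn : 𝔸.Connection) : LocalForm 𝕜 E 𝔤 n U :=
  Matrix.detRowAlternating.compLinearMap (LinearMap.pi fun a => T.mixedBasis e conn a)

/-- The matrix of functions `h(Ψ(e_a), Ψ(e_b))` on `U`. -/
def metricMatrix (conn : 𝔸.Connection) (h : LinearMap.BilinForm (Cinf 𝕜 E M) 𝔸.kernel) :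
    Matrix (Fin n) (Fin n) (Cinf 𝕜 E U) :=
  Matrix.of fun a b =>
    conn.metricOn h U (T.Psi (sectionBasis E U e a)) (T.Psi (sectionBasis E U e b))

/-- The square root of the absolute value of the determinant of the matrix of `h`. -/
def sqrtAbsDet (conn : 𝔸.Connection) (h : LinearMap.BilinForm (Cinf 𝕜 E M) 𝔸.kernel) (x : U) : ℝ :=
  √‖(T.metricMatrix e conn h).det x‖

/-- `η` is the local expression of the global form `Ω` in the trivialization, that is, `η = Ω ∘ S`:
`η(Z_1, …, Z_n) = Ω(a_1, …, a_n)|_U` whenever `S(Z_k) = a_k|_U`. -/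
def IsLocalExpression (Ω : A [⋀^Fin n]→ₗ[Cinf 𝕜 E M] Cinf 𝕜 E M) (η : LocalForm 𝕜 E 𝔤 n U) :
    Prop :=
  ∀ a : Fin n → A, η (fun k => T.S.symm (1 ⊗ₜ a k)) = algebraMap _ _ (Ω a)

end LocalTrivialization

/-- A Lie algebroid atlas. -/
structure Atlas (ι : Type*) where
  U : ι → Opens M
  triv : ∀ i, 𝔸.LocalTrivialization 𝔤 (U i)
  cover : ∀ x : M, ∃ i, x ∈ U i

namespace Atlas
variable {𝔸 𝔤} {ι : Type*} (𝓐 : 𝔸.Atlas 𝔤 ι) {n : ℕ} (e : Module.Basis (Fin n) 𝕜 𝔤)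

/-- The `i`-th trivialization over `U_i ∩ U_j`. -/
def trivFst (i j : ι) : 𝔸.LocalTrivialization 𝔤 (𝓐.U i ⊓ 𝓐.U j) :=
  (𝓐.triv i).restrict inf_le_left

/-- The `j`-th trivialization over `U_i ∩ U_j`. -/
def trivSnd (i j : ι) : 𝔸.LocalTrivialization 𝔤 (𝓐.U i ⊓ 𝓐.U j) :=
  (𝓐.triv j).restrict inf_le_right

/-- The atlas is oriented: the determinants of the matrices of the transition maps `Ψ_i⁻¹ ∘ Ψ_j` are
positive real numbers at every point of `U_i ∩ U_j`. The kernel is orientable if it has such an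
atlas. -/
def IsOriented : Prop :=
  ∀ (i j : ι) (x : (𝓐.U i ⊓ 𝓐.U j : Opens M)),
    0 < RCLike.re (((𝓐.trivFst i j).transitionMatrix e (𝓐.trivSnd i j)).det x) ∧
      RCLike.im (((𝓐.trivFst i j).transitionMatrix e (𝓐.trivSnd i j)).det x) = 0

/-- `f` is the inner integral of the `n`-form `Ω`: on every `U_i`, the coefficient of
`√|h| θ^1 ∧ ⋯ ∧ θ^n` in the local expression of `Ω`, with `θ` the basis dual to `e`, is `f`. -/
def IsInnerIntegral (conn : 𝔸.Connection) (h : LinearMap.BilinForm (Cinf 𝕜 E M) 𝔸.kernel)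
    (Ω : A [⋀^Fin n]→ₗ[Cinf 𝕜 E M] Cinf 𝕜 E M) (f : Cinf 𝕜 E M) : Prop :=
  ∀ (i : ι) (η : LocalForm 𝕜 E 𝔤 n (𝓐.U i)), (𝓐.triv i).IsLocalExpression Ω η →
    ∀ x : 𝓐.U i,
      η (fun a => (0, LocalTrivialization.sectionBasis E (𝓐.U i) e a)) x =
        f x * (((𝓐.triv i).sqrtAbsDet e conn h x : ℝ) : 𝕜)

end Atlas

end LieAlgebroid

end

section SmoothFunctions
variable {𝕜 : Type*} [RCLike 𝕜] {E : Type*} [NormedAddCommGroup E] [NormedSpace ℝ E]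

namespace Cinf
variable {N : Type*} [TopologicalSpace N] [ChartedSpace E N]

variable (𝕜 E) in
/-- Evaluation at a point, as a ring morphism. -/
def evalAt (x : N) : Cinf 𝕜 E N →+* 𝕜 where
  toFun f := f x
  map_one' := rfl
  map_mul' _ _ := rfl
  map_zero' := rfl
  map_add' _ _ := rfl

@[simp] theorem one_apply (x : N) : (1 : Cinf 𝕜 E N) x = 1 := rfl

@[simp] theorem zero_apply (x : N) : (0 : Cinf 𝕜 E N) x = 0 := rfl

@[simp] theorem neg_apply (f : Cinf 𝕜 E N) (x : N) : (-f) x = -f x := rfl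

@[simp] theorem pow_apply (f : Cinf 𝕜 E N) (k : ℕ) (x : N) : (f ^ k) x = f x ^ k :=
  map_pow (evalAt 𝕜 E x) f k

@[simp] theorem algebraMap_apply (c : 𝕜) (x : N) : algebraMap 𝕜 (Cinf 𝕜 E N) c x = c := rfl

theorem det_apply {n : ℕ} (B : Matrix (Fin n) (Fin n) (Cinf 𝕜 E N)) (x : N) :
    B.det x = (B.map (evalAt 𝕜 E x)).det :=
  RingHom.map_det (evalAt 𝕜 E x) B

/-- The square root of the absolute value of a nowhere vanishing smooth function is smooth. -/
theorem contMDiff_sqrt_norm (f : Cinf 𝕜 E N) (hf : ∀ x, f x ≠ 0) :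
    ContMDiff 𝓘(ℝ, E) 𝓘(ℝ, 𝕜) ∞ (fun x => ((√‖f x‖ : ℝ) : 𝕜)) := by
  intro x
  have h0 : RCLike.re (f x) * RCLike.re (f x) + RCLike.im (f x) * RCLike.im (f x) ≠ 0 := by
    rw [← RCLike.normSq_apply]
    simpa using hf x
  have h1 : ContDiffAt ℝ ∞ (fun z : 𝕜 => RCLike.re z * RCLike.re z + RCLike.im z * RCLike.im z)
      (f x) :=
    (((RCLike.reCLM (K := 𝕜)).contDiff.mul (RCLike.reCLM (K := 𝕜)).contDiff).add
      ((RCLike.imCLM (K := 𝕜)).contDiff.mul (RCLike.imCLM (K := 𝕜)).contDiff)).contDiffAt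
  have h2 := (h1.sqrt h0).sqrt (by
    rw [Real.sqrt_ne_zero']
    exact lt_of_le_of_ne (add_nonneg (mul_self_nonneg _) (mul_self_nonneg _)) h0.symm)
  have h3 : ContDiffAt ℝ ∞ (fun z : 𝕜 => ((√‖z‖ : ℝ) : 𝕜)) (f x) := by
    refine ((RCLike.ofRealCLM (K := 𝕜)).contDiff.contDiffAt.comp (f x) h2).congr_of_eventuallyEq
      (.of_forall fun z => ?_)
    simp only [Function.comp_apply, RCLike.ofRealCLM_apply, ← RCLike.normSq_apply,
      RCLike.sqrt_normSq_eq_norm]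
  exact ContMDiffAt.comp (g := fun z : 𝕜 => ((√‖z‖ : ℝ) : 𝕜)) x h3.contMDiffAt (f.contMDiff x)

end Cinf

variable {M : Type*} [TopologicalSpace M] [ChartedSpace E M]

@[simp] theorem restrictLE_apply {V U : Opens M} (hVU : V ≤ U) (f : Cinf 𝕜 E U) (x : V) :
    restrictLE hVU f x = f (Set.inclusion hVU x) := rfl

variable [FiniteDimensional ℝ E] [T2Space M] [IsManifold 𝓘(ℝ, E) ∞ M]

/-- Up to a cut-off function, every section over `U` is the restriction of a global section. -/
theorem exists_cutoff_smul_eq_tmul {A : Type*} [AddCommGroup A] [Module (Cinf 𝕜 E M) A]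
    {U : Opens M} (x : U) (t : Cinf 𝕜 E U ⊗[Cinf 𝕜 E M] A) :
    ∃ (χ : Cinf 𝕜 E M) (a : A), χ x = 1 ∧ χ • t = 1 ⊗ₜ a := by
  induction t with
  | zero => exact ⟨1, 0, rfl, by simp⟩
  | tmul f b =>
    obtain ⟨χ, h1, h2⟩ := exists_cutoff (E := E) 𝕜 U x
    obtain ⟨F, hF⟩ := exists_global_extension U χ h2 f
    refine ⟨χ, F • b, h1.self_of_nhds, ?_⟩
    have : χ • f = F • (1 : Cinf 𝕜 E U) := Cinf.ext fun y => by
      simp [Algebra.smul_def, hF]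
    rw [TensorProduct.smul_tmul', this, TensorProduct.smul_tmul]
  | add s t hs ht =>
    obtain ⟨χ, a, h1, h2⟩ := hs
    obtain ⟨χ', a', h1', h2'⟩ := ht
    refine ⟨χ * χ', χ' • a + χ • a', by simp [h1, h1'], ?_⟩
    rw [smul_add, mul_smul, mul_smul, h2', smul_comm, h2, TensorProduct.tmul_add,
      TensorProduct.tmul_smul, TensorProduct.tmul_smul]

end SmoothFunctions

namespace LieAlgebroid

variable {𝕜 : Type*} [RCLike 𝕜] {E : Type*} [NormedAddCommGroup E] [NormedSpace ℝ E]
  [FiniteDimensional ℝ E] {M : Type*} [TopologicalSpace M] [ChartedSpace E M]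
  [T2Space M] [IsManifold 𝓘(ℝ, E) ∞ M]
  {A : Type*} [LieRing A] [Module (Cinf 𝕜 E M) A] (𝔸 : LieAlgebroid 𝕜 E M A)

/-- Up to a cut-off function, every section over `U` of the kernel is the restriction of a global
section of the kernel. -/
theorem exists_cutoff_smul_eq_restrictKernel {U : Opens M} (x : U) (t : 𝔸.kernelOn U) :
    ∃ (χ : Cinf 𝕜 E M) (ℓ : 𝔸.kernel), χ x = 1 ∧
      algebraMap _ (Cinf 𝕜 E U) χ • t = 𝔸.restrictKernel U ℓ := by
  obtain ⟨χ, a, h1, h2⟩ := exists_cutoff_smul_eq_tmul x (t : Cinf 𝕜 E U ⊗[Cinf 𝕜 E M] A)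
  obtain ⟨χ', h1', hs⟩ := exists_cutoff (E := E) 𝕜 U x
  have h0 : restrictVF U (𝔸.anchor a) = 0 := by
    have h3 := congrArg (𝔸.anchorOn U) h2
    rw [anchorOn_tmul, one_smul, ← algebraMap_smul (Cinf 𝕜 E U) χ, map_smul,
      LinearMap.mem_ker.1 t.2, smul_zero] at h3
    exact h3.symm
  have ha : 𝔸.anchor (χ' • a) = 0 := by
    refine Derivation.ext fun f => Cinf.ext fun y => ?_
    rw [map_smul, Derivation.smul_apply, smul_eq_mul, Cinf.mul_apply]
    by_cases hy : y ∈ tsupport χ'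
    · have h4 := congrArg (fun g => g (⟨y, hs hy⟩ : U))
        (restrictVF_algebraMap (U := U) (𝔸.anchor a) f)
      simp only [h0, Derivation.zero_apply, Cinf.zero_apply, algebraMap_restrict_apply] at h4
      rw [← h4, mul_zero]
      rfl
    · rw [image_eq_zero_of_notMem_tsupport hy, zero_mul]
      rfl
  refine ⟨χ' * χ, ⟨χ' • a, ha⟩, by simp [h1, h1'.self_of_nhds], Subtype.ext ?_⟩
  change algebraMap _ (Cinf 𝕜 E U) (χ' * χ) • (t : Cinf 𝕜 E U ⊗[Cinf 𝕜 E M] A) = 1 ⊗ₜ (χ' • a)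
  rw [algebraMap_smul, mul_smul, h2, TensorProduct.tmul_smul]

namespace Connection
variable {𝔸} (conn : 𝔸.Connection)

theorem formOn_tmul (U : Opens M) (f : Cinf 𝕜 E U) (a : A) :
    (conn.formOn U (f ⊗ₜ a) : Cinf 𝕜 E U ⊗[Cinf 𝕜 E M] A) = f ⊗ₜ (conn.form a : A) := rfl

theorem formOn_restrictKernel (U : Opens M) (ℓ : 𝔸.kernel) :
    conn.formOn U (𝔸.restrictKernel U ℓ) = (-1 : Cinf 𝕜 E U) • 𝔸.restrictKernel U ℓ := by
  refine Subtype.ext ?_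
  change (1 : Cinf 𝕜 E U) ⊗ₜ[Cinf 𝕜 E M] (conn.form (ℓ : A) : A) =
    (-1 : Cinf 𝕜 E U) • (1 ⊗ₜ[Cinf 𝕜 E M] (ℓ : A))
  rw [conn.form_kernel, Submodule.coe_neg, TensorProduct.tmul_neg, TensorProduct.smul_tmul',
    smul_eq_mul, mul_one, TensorProduct.neg_tmul]

/-- On linear functionals, the connection form over `U` is minus the identity on the kernel. -/
theorem apply_formOn_kernelOn {U : Opens M} (φ : 𝔸.kernelOn U →ₗ[Cinf 𝕜 E U] Cinf 𝕜 E U)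
    (t : 𝔸.kernelOn U) : φ (conn.formOn U t) = -φ t := by
  refine Cinf.ext fun x => ?_
  obtain ⟨χ, ℓ, h1, h2⟩ := 𝔸.exists_cutoff_smul_eq_restrictKernel x t
  have h3 : φ (conn.formOn U (algebraMap _ (Cinf 𝕜 E U) χ • t : 𝔸.kernelOn U)) =
      -φ (algebraMap _ (Cinf 𝕜 E U) χ • t) := by
    rw [h2, formOn_restrictKernel, map_smul, neg_one_smul]
  rw [Submodule.coe_smul, map_smul, map_smul, map_smul] at h3
  have h4 := congrArg (fun f => f x) h3
  simpa [h1] using h4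

theorem baseChange_pullbackMetric_restrictSections (h : LinearMap.BilinForm (Cinf 𝕜 E M) 𝔸.kernel)
    {V U : Opens M} (hVU : V ≤ U) (s t : Cinf 𝕜 E U ⊗[Cinf 𝕜 E M] A) :
    (conn.pullbackMetric h).baseChange (Cinf 𝕜 E V) (restrictSections hVU s)
        (restrictSections hVU t) =
      restrictLE hVU ((conn.pullbackMetric h).baseChange (Cinf 𝕜 E U) s t) := by
  induction s with
  | zero => simp
  | add s s' hs hs' => simp only [map_add, LinearMap.add_apply, hs, hs']
  | tmul f a =>
    induction t with
    | zero => simp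
    | add t t' ht ht' => simp only [map_add, ht, ht']
    | tmul g b => simp [restrictSections]

end Connection

variable {𝔤 : Type*} [LieRing 𝔤] [LieAlgebra 𝕜 𝔤] {𝔸}

namespace LocalTrivialization

variable {U : Opens M} (T T' : 𝔸.LocalTrivialization 𝔤 U) {n : ℕ} (e : Module.Basis (Fin n) 𝕜 𝔤)
  (conn : 𝔸.Connection) (h : LinearMap.BilinForm (Cinf 𝕜 E M) 𝔸.kernel)

theorem Psi_alpha (γ : Cinf 𝕜 E U ⊗[𝕜] 𝔤) : T.Psi (T.alpha T' γ) = T'.Psi γ :=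
  T.Psi.apply_symm_apply _

theorem metricMatrix_eq_toMatrix : T.metricMatrix e conn h =
    LinearMap.BilinForm.toMatrix (sectionBasis E U e)
      ((conn.metricOn h U).compl₁₂ T.Psi.toLinearMap T.Psi.toLinearMap) := by
  ext a b
  simp [metricMatrix, LinearMap.BilinForm.toMatrix_apply]

theorem metricMatrix_change : T'.metricMatrix e conn h =
    (T.transitionMatrix e T').transpose * T.metricMatrix e conn h * T.transitionMatrix e T' := by
  rw [metricMatrix_eq_toMatrix, metricMatrix_eq_toMatrix, transitionMatrix,
    ← LinearMap.BilinForm.toMatrix_comp]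
  congr 1
  refine LinearMap.ext₂ fun γ η => ?_
  change _ = conn.metricOn h U (T.Psi (T.alpha T' γ)) (T.Psi (T.alpha T' η))
  rw [Psi_alpha, Psi_alpha]
  rfl

theorem det_metricMatrix_apply_ne_zero (hh : 𝔸.FiberwiseNondegenerate h) (x : U) :
    (T.metricMatrix e conn h).det x ≠ 0 := by
  rw [Cinf.det_apply]
  intro h0
  obtain ⟨v, hv, hv0⟩ := Matrix.exists_vecMul_eq_zero_iff.2 h0
  let b := sectionBasis E U e
  let γ := b.equivFun.symm fun a => algebraMap 𝕜 (Cinf 𝕜 E U) (v a)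
  obtain ⟨χ, ℓ, h1, h2⟩ := 𝔸.exists_cutoff_smul_eq_restrictKernel x (T.Psi γ)
  have hγ : ∀ a, b.repr (T.Psi.symm (𝔸.restrictKernel U ℓ)) a x = v a := fun a => by
    rw [← h2, map_smul, LinearEquiv.symm_apply_apply, map_smul, Finsupp.smul_apply,
      ← Module.Basis.equivFun_apply, LinearEquiv.apply_symm_apply]
    simp [h1]
  have hℓ : ∀ ℓ', h ℓ ℓ' x = 0 := fun ℓ' => by
    have h3 := LinearMap.BilinForm.apply_eq_dotProduct_toMatrix_mulVec b
      ((conn.metricOn h U).compl₁₂ T.Psi.toLinearMap T.Psi.toLinearMap)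
      (T.Psi.symm (𝔸.restrictKernel U ℓ)) (T.Psi.symm (𝔸.restrictKernel U ℓ'))
    rw [← metricMatrix_eq_toMatrix] at h3
    simp only [LinearMap.compl₁₂_apply, LinearEquiv.coe_coe, LinearEquiv.apply_symm_apply,
      conn.metricOn_restrictKernel] at h3
    have h4 := congrArg (Cinf.evalAt 𝕜 E x) h3
    rw [RingHom.map_dotProduct,
      show Cinf.evalAt 𝕜 E x ∘ (T.metricMatrix e conn h).mulVec _ = _ from
        funext (RingHom.map_mulVec _ _ _), Matrix.dotProduct_mulVec] at h4
    have h5 : (Cinf.evalAt 𝕜 E x) ∘ (b.repr (T.Psi.symm (𝔸.restrictKernel U ℓ))) = v :=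
      funext hγ
    rw [h5, hv0, zero_dotProduct] at h4
    exact h4
  have key : ∀ ℓ' ∈ (Ideal.span {f : Cinf 𝕜 E M | f x = 0}) •
      (⊤ : Submodule (Cinf 𝕜 E M) 𝔸.kernel),
      ∀ a, b.repr (T.Psi.symm (𝔸.restrictKernel U ℓ')) a x = 0 := by
    intro ℓ' hℓ'
    induction hℓ' using Submodule.smul_induction_on' with
    | smul f hf m _ =>
      intro a
      have hfx : f x = 0 := by
        have : Ideal.span {f : Cinf 𝕜 E M | f x = 0} ≤ RingHom.ker (Cinf.evalAt 𝕜 E (x : M)) :=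
          Ideal.span_le.2 fun g hg => hg
        exact this hf
      have : 𝔸.restrictKernel U (f • m) =
          algebraMap _ (Cinf 𝕜 E U) f • 𝔸.restrictKernel U m := by
        refine Subtype.ext ?_
        change (1 : Cinf 𝕜 E U) ⊗ₜ[Cinf 𝕜 E M] (f • (m : A)) =
          algebraMap _ (Cinf 𝕜 E U) f • ((1 : Cinf 𝕜 E U) ⊗ₜ[Cinf 𝕜 E M] (m : A))
        rw [algebraMap_smul, TensorProduct.tmul_smul]
      rw [this, map_smul, map_smul, Finsupp.smul_apply, smul_eq_mul, Cinf.mul_apply,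
        algebraMap_restrict_apply, hfx, zero_mul]
    | add m _ m' _ hm hm' =>
      intro a
      have : 𝔸.restrictKernel U (m + m') = 𝔸.restrictKernel U m + 𝔸.restrictKernel U m' :=
        Subtype.ext (TensorProduct.tmul_add _ _ _)
      rw [this, map_add, map_add, Finsupp.add_apply, Cinf.add_apply, hm, hm', add_zero]
  exact hv (funext fun a => (hγ a).symm.trans (key ℓ (hh x ℓ hℓ) a))

/-- The square root of the absolute value of the determinant of a nondegenerate inner metric, as a
smooth function. -/
noncomputable def sqrtAbsDetSmooth (hh : 𝔸.FiberwiseNondegenerate h) : Cinf 𝕜 E U :=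
  Cinf.mk (fun x => ((T.sqrtAbsDet e conn h x : ℝ) : 𝕜))
    (Cinf.contMDiff_sqrt_norm _ (T.det_metricMatrix_apply_ne_zero e conn h hh))

theorem sqrtAbsDetSmooth_apply (hh : 𝔸.FiberwiseNondegenerate h) (x : U) :
    T.sqrtAbsDetSmooth e conn h hh x = ((T.sqrtAbsDet e conn h x : ℝ) : 𝕜) := rfl

theorem sqrtAbsDet_change (x : U) : T'.sqrtAbsDet e conn h x =
    ‖(T.transitionMatrix e T').det x‖ * T.sqrtAbsDet e conn h x := by
  rw [sqrtAbsDet, sqrtAbsDet, T.metricMatrix_change T', Matrix.det_mul, Matrix.det_mul,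
    Matrix.det_transpose, Cinf.mul_apply, Cinf.mul_apply, norm_mul, norm_mul,
    show ∀ a b : ℝ, a * b * a = a ^ 2 * b by intros; ring, Real.sqrt_mul (by positivity),
    Real.sqrt_sq (norm_nonneg _)]

theorem mixedBasis_apply (a : Fin n) (z : TLA 𝕜 E 𝔤 U) : T.mixedBasis e conn a z =
    (sectionBasis E U e).repr (T.Psi.symm (conn.formOn U (T.S z))) a := rfl

theorem mixedTopForm_apply (Z : Fin n → TLA 𝕜 E 𝔤 U) : T.mixedTopForm e conn Z =
    (Matrix.of fun k a => T.mixedBasis e conn a (Z k)).det := rfl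

theorem transport_mixedTopForm : transport T T' (T.mixedTopForm e conn) =
    (T.transitionMatrix e T').det • T'.mixedTopForm e conn := by
  ext1 Z
  rw [AlternatingMap.smul_apply, smul_eq_mul, mul_comm,
    ← Matrix.det_transpose (T.transitionMatrix e T'),
    mixedTopForm_apply, ← Matrix.det_mul]
  change T.mixedTopForm e conn (fun k => T.S.symm (T'.S (Z k))) = _
  rw [mixedTopForm_apply]
  congr 1
  ext1 k a
  simp only [Matrix.of_apply, mixedBasis_apply, LinearEquiv.apply_symm_apply]
  have h1 := congrFun (LinearMap.toMatrix_mulVec_repr (sectionBasis E U e) (sectionBasis E U e)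
    (T.alpha T').toLinearMap (T'.Psi.symm (conn.formOn U (T'.S (Z k))))) a
  have h2 : (T.alpha T').toLinearMap (T'.Psi.symm (conn.formOn U (T'.S (Z k)))) =
      T.Psi.symm (conn.formOn U (T'.S (Z k))) := by
    change T.Psi.symm (T'.Psi (T'.Psi.symm _)) = _
    rw [LinearEquiv.apply_symm_apply]
  rw [h2] at h1
  rw [← h1, Matrix.mul_apply, Matrix.mulVec, dotProduct]
  exact Finset.sum_congr rfl fun b _ => mul_comm _ _

/-- The mixed top form on the constant sections of the model Lie algebra. -/
theorem mixedTopForm_sectionBasis :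
    T.mixedTopForm e conn (fun a => (0, sectionBasis E U e a)) = (-1) ^ n := by
  have h1 : ∀ k a, T.mixedBasis e conn a (0, sectionBasis E U e k) =
      -(1 : Matrix (Fin n) (Fin n) (Cinf 𝕜 E U)) k a := fun k a => by
    have h2 := conn.apply_formOn_kernelOn
      (((sectionBasis E U e).coord a).comp T.Psi.symm.toLinearMap) (T.Psi (sectionBasis E U e k))
    rw [mixedBasis_apply, S_apply, map_zero, zero_add]
    refine h2.trans ?_
    simp [Finsupp.single_apply, Matrix.one_apply]
  rw [mixedTopForm_apply]
  have h3 : (Matrix.of fun k a => T.mixedBasis e conn a (0, sectionBasis E U e k)) =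
      -(1 : Matrix (Fin n) (Fin n) (Cinf 𝕜 E U)) := by
    ext1 k a
    exact h1 k a
  rw [h3, Matrix.det_neg, Matrix.det_one, mul_one, Fintype.card_fin]

section Restrict
variable {V : Opens M} (hVU : V ≤ U)

theorem restrict_Psi (γ : Cinf 𝕜 E U ⊗[𝕜] 𝔤) :
    ((T.restrict hVU).Psi (((restrictLE hVU).restrictScalars 𝕜).toLinearMap.rTensor 𝔤 γ) :
      Cinf 𝕜 E V ⊗[Cinf 𝕜 E M] A) = restrictSections hVU (T.Psi γ : Cinf 𝕜 E U ⊗[Cinf 𝕜 E M] A) :=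
  (T.psi_restrict U le_rfl V hVU γ).symm

theorem rTensor_sectionBasis (a : Fin n) :
    ((restrictLE hVU).restrictScalars 𝕜).toLinearMap.rTensor 𝔤 (sectionBasis E U e a) =
      sectionBasis (𝕜 := 𝕜) E V e a := by
  simp [sectionBasis]

theorem repr_rTensor (γ : Cinf 𝕜 E U ⊗[𝕜] 𝔤) (a : Fin n) :
    (sectionBasis E V e).repr
        (((restrictLE hVU).restrictScalars 𝕜).toLinearMap.rTensor 𝔤 γ) a =
      restrictLE hVU ((sectionBasis (𝕜 := 𝕜) E U e).repr γ a) := by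
  induction γ with
  | zero => simp
  | add s t hs ht => simp only [map_add, Finsupp.add_apply, hs, ht]
  | tmul f v =>
    simp [sectionBasis, Algebra.smul_def]

theorem metricMatrix_restrict : (T.restrict hVU).metricMatrix e conn h =
    (T.metricMatrix e conn h).map (restrictLE hVU) := by
  ext1 a b
  change (conn.pullbackMetric h).baseChange (Cinf 𝕜 E V)
      ((T.restrict hVU).Psi (sectionBasis E V e a)) ((T.restrict hVU).Psi (sectionBasis E V e b)) =
    restrictLE hVU ((conn.pullbackMetric h).baseChange (Cinf 𝕜 E U)
      (T.Psi (sectionBasis E U e a)) (T.Psi (sectionBasis E U e b)))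
  rw [← rTensor_sectionBasis e hVU, ← rTensor_sectionBasis e hVU, restrict_Psi, restrict_Psi,
    conn.baseChange_pullbackMetric_restrictSections]

theorem sqrtAbsDet_restrict (x : V) : (T.restrict hVU).sqrtAbsDet e conn h x =
    T.sqrtAbsDet e conn h (Set.inclusion hVU x) := by
  rw [sqrtAbsDet, sqrtAbsDet, metricMatrix_restrict]
  congr 2
  exact congrArg (fun f => f x) (RingHom.map_det (restrictLE hVU).toRingHom
    (T.metricMatrix e conn h)).symm

theorem mixedTopForm_restrict (a : Fin n → A) :
    (T.restrict hVU).mixedTopForm e conn (fun k => (T.restrict hVU).S.symm (1 ⊗ₜ a k)) =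
      restrictLE hVU (T.mixedTopForm e conn (fun k => T.S.symm (1 ⊗ₜ a k))) := by
  rw [mixedTopForm_apply, mixedTopForm_apply]
  refine Eq.trans ?_ (RingHom.map_det (restrictLE hVU).toRingHom _).symm
  congr 1
  ext1 k b
  simp only [Matrix.of_apply, mixedBasis_apply, LinearEquiv.apply_symm_apply]
  refine Eq.trans ?_ (repr_rTensor e hVU _ b)
  congr 2
  rw [LinearEquiv.symm_apply_eq]
  refine Subtype.ext ?_
  rw [restrict_Psi, LinearEquiv.apply_symm_apply, conn.formOn_tmul, conn.formOn_tmul]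
  simp [restrictSections]

end Restrict

variable {T e} in
/-- A global form has at most one local expression. -/
theorem IsLocalExpression.unique {Ω : A [⋀^Fin n]→ₗ[Cinf 𝕜 E M] Cinf 𝕜 E M}
    {η η' : LocalForm 𝕜 E 𝔤 n U} (hη : T.IsLocalExpression Ω η)
    (hη' : T.IsLocalExpression Ω η') : η = η' := by
  let l := Finsupp.linearCombination (Cinf 𝕜 E U) fun a : A => T.S.symm (1 ⊗ₜ a)
  have hl : Function.Surjective l := by
    rw [← LinearMap.range_eq_top, Finsupp.range_linearCombination, eq_top_iff]
    rintro z -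
    rw [← T.S.symm_apply_apply z]
    induction T.S z with
    | zero => simp
    | add s t hs ht => rw [map_add]; exact add_mem hs ht
    | tmul f a =>
      rw [← mul_one f, ← smul_eq_mul, ← TensorProduct.smul_tmul', map_smul]
      exact Submodule.smul_mem _ _ (Submodule.subset_span ⟨a, rfl⟩)
  refine AlternatingMap.compLinearMap_injective l hl ?_
  refine Module.Basis.ext_alternating Finsupp.basisSingleOne fun a _ => ?_
  have h1 := (hη a).trans (hη' a).symm
  simpa [l] using h1

end LocalTrivialization

namespace Atlas

variable {ι : Type*} (𝓐 : 𝔸.Atlas 𝔤 ι) {n : ℕ} (e : Module.Basis (Fin n) 𝕜 𝔤)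
  (conn : 𝔸.Connection) (h : LinearMap.BilinForm (Cinf 𝕜 E M) 𝔸.kernel)
  (hh : 𝔸.FiberwiseNondegenerate h)

/-- The forms `√|h| ϖ^1 ∧ ⋯ ∧ ϖ^n` of an oriented atlas are compatible on overlaps. -/
theorem transport_sqrtAbsDet_smul_mixedTopForm (ho : 𝓐.IsOriented e) (i j : ι) :
    LocalTrivialization.transport (𝓐.trivFst i j) (𝓐.trivSnd i j)
        (restrictLE (V := 𝓐.U i ⊓ 𝓐.U j) inf_le_left ((𝓐.triv i).sqrtAbsDetSmooth e conn h hh) •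
          (𝓐.trivFst i j).mixedTopForm e conn) =
      restrictLE (V := 𝓐.U i ⊓ 𝓐.U j) inf_le_right ((𝓐.triv j).sqrtAbsDetSmooth e conn h hh) •
        (𝓐.trivSnd i j).mixedTopForm e conn := by
  have h1 := (𝓐.trivFst i j).transport_mixedTopForm (𝓐.trivSnd i j) e conn
  have h2 : restrictLE (V := 𝓐.U i ⊓ 𝓐.U j) inf_le_right
        ((𝓐.triv j).sqrtAbsDetSmooth e conn h hh) =
      restrictLE (V := 𝓐.U i ⊓ 𝓐.U j) inf_le_left ((𝓐.triv i).sqrtAbsDetSmooth e conn h hh) *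
        ((𝓐.trivFst i j).transitionMatrix e (𝓐.trivSnd i j)).det := by
    refine Cinf.ext fun x => ?_
    obtain ⟨hre, him⟩ := ho i j x
    set d := ((𝓐.trivFst i j).transitionMatrix e (𝓐.trivSnd i j)).det x with hd
    have hdr : ((RCLike.re d : ℝ) : 𝕜) = d := RCLike.conj_eq_iff_re.1 (RCLike.conj_eq_iff_im.2 him)
    have hdn : ((‖d‖ : ℝ) : 𝕜) = d := by
      rw [← hdr, RCLike.norm_ofReal, abs_of_pos hre]
    rw [Cinf.mul_apply, restrictLE_apply, restrictLE_apply,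
      LocalTrivialization.sqrtAbsDetSmooth_apply, LocalTrivialization.sqrtAbsDetSmooth_apply,
      ← LocalTrivialization.sqrtAbsDet_restrict, ← LocalTrivialization.sqrtAbsDet_restrict]
    change (((𝓐.trivSnd i j).sqrtAbsDet e conn h x : ℝ) : 𝕜) =
      (((𝓐.trivFst i j).sqrtAbsDet e conn h x : ℝ) : 𝕜) * d
    rw [(𝓐.trivFst i j).sqrtAbsDet_change (𝓐.trivSnd i j), RCLike.ofReal_mul, ← hd, hdn, mul_comm]
  rw [h2, mul_smul, ← h1]
  rfl

/-- The local expression `(-1)^n √|h| ϖ^1 ∧ ⋯ ∧ ϖ^n` of the volume form. -/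
noncomputable def localVolume (i : ι) : LocalForm 𝕜 E 𝔤 n (𝓐.U i) :=
  ((-1 : Cinf 𝕜 E (𝓐.U i)) ^ n * (𝓐.triv i).sqrtAbsDetSmooth e conn h hh) •
    (𝓐.triv i).mixedTopForm e conn

theorem localVolume_agree (ho : 𝓐.IsOriented e) (a : Fin n → A) (i j : ι) (x : M)
    (hi : x ∈ 𝓐.U i) (hj : x ∈ 𝓐.U j) :
    𝓐.localVolume e conn h hh i (fun k => (𝓐.triv i).S.symm (1 ⊗ₜ a k)) ⟨x, hi⟩ =
      𝓐.localVolume e conn h hh j (fun k => (𝓐.triv j).S.symm (1 ⊗ₜ a k)) ⟨x, hj⟩ := by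
  have h1 := congrArg (fun η : LocalForm 𝕜 E 𝔤 n (𝓐.U i ⊓ 𝓐.U j : Opens M) =>
      η (fun k => (𝓐.trivSnd i j).S.symm (1 ⊗ₜ a k)) ⟨x, hi, hj⟩)
    (𝓐.transport_sqrtAbsDet_smul_mixedTopForm e conn h hh ho i j)
  have h2 : (fun k => (𝓐.trivFst i j).S.symm
      ((𝓐.trivSnd i j).S ((𝓐.trivSnd i j).S.symm (1 ⊗ₜ a k)))) =
      fun k => (𝓐.trivFst i j).S.symm (1 ⊗ₜ a k) :=
    funext fun k => by rw [LinearEquiv.apply_symm_apply]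
  change (restrictLE (V := 𝓐.U i ⊓ 𝓐.U j) inf_le_left
      ((𝓐.triv i).sqrtAbsDetSmooth e conn h hh) • (𝓐.trivFst i j).mixedTopForm e conn)
    (fun k => (𝓐.trivFst i j).S.symm
      ((𝓐.trivSnd i j).S ((𝓐.trivSnd i j).S.symm (1 ⊗ₜ a k)))) _ = _ at h1
  rw [h2] at h1
  simp only [AlternatingMap.smul_apply, smul_eq_mul, Cinf.mul_apply] at h1
  have h3 : (𝓐.trivFst i j).mixedTopForm e conn (fun k => (𝓐.trivFst i j).S.symm (1 ⊗ₜ a k)) = _ :=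
    LocalTrivialization.mixedTopForm_restrict (𝓐.triv i) e conn
      (V := 𝓐.U i ⊓ 𝓐.U j) inf_le_left a
  have h4 : (𝓐.trivSnd i j).mixedTopForm e conn (fun k => (𝓐.trivSnd i j).S.symm (1 ⊗ₜ a k)) = _ :=
    LocalTrivialization.mixedTopForm_restrict (𝓐.triv j) e conn
      (V := 𝓐.U i ⊓ 𝓐.U j) inf_le_right a
  rw [h3, h4] at h1
  simp only [localVolume, AlternatingMap.smul_apply, smul_eq_mul, Cinf.mul_apply, Cinf.pow_apply,
    Cinf.neg_apply, Cinf.one_apply, mul_assoc]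
  exact congrArg _ h1

/-- Local forms which agree on overlaps glue to a global form. -/
theorem exists_isLocalExpression (η : ∀ i, LocalForm 𝕜 E 𝔤 n (𝓐.U i))
    (hη : ∀ (a : Fin n → A) (i j : ι) (x : M) (hi : x ∈ 𝓐.U i) (hj : x ∈ 𝓐.U j),
      η i (fun k => (𝓐.triv i).S.symm (1 ⊗ₜ a k)) ⟨x, hi⟩ =
        η j (fun k => (𝓐.triv j).S.symm (1 ⊗ₜ a k)) ⟨x, hj⟩) :
    ∃ Ω : A [⋀^Fin n]→ₗ[Cinf 𝕜 E M] Cinf 𝕜 E M, ∀ i, (𝓐.triv i).IsLocalExpression Ω (η i) := by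
  choose idx hidx using 𝓐.cover
  let loc : ∀ i, A [⋀^Fin n]→ₗ[Cinf 𝕜 E M] Cinf 𝕜 E (𝓐.U i) := fun i =>
    { ((η i).toMultilinearMap.restrictScalars (Cinf 𝕜 E M)).compLinearMap fun _ =>
        ((𝓐.triv i).S.symm.toLinearMap.restrictScalars (Cinf 𝕜 E M)).comp
          (TensorProduct.mk (Cinf 𝕜 E M) (Cinf 𝕜 E (𝓐.U i)) A 1) with
      map_eq_zero_of_eq' := fun a k l hkl hne =>
        (η i).map_eq_zero_of_eq _ (by rw [hkl]) hne }
  have hsm : ∀ a : Fin n → A, ContMDiff 𝓘(ℝ, E) 𝓘(ℝ, 𝕜) ∞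
      (fun x : M => loc (idx x) a ⟨x, hidx x⟩) := by
    intro a x
    refine (contMDiffAt_subtype_iff (U := 𝓐.U (idx x)) (x := ⟨x, hidx x⟩)).1 ?_
    refine ((loc (idx x) a).contMDiff ⟨x, hidx x⟩).congr_of_eventuallyEq (.of_forall fun y => ?_)
    exact hη a _ _ y (hidx y) y.2
  let Ω : A [⋀^Fin n]→ₗ[Cinf 𝕜 E M] Cinf 𝕜 E M :=
    { toFun := fun a => Cinf.mk _ (hsm a)
      map_update_add' := fun a k b c => Cinf.ext fun x => by
        rw [Cinf.add_apply]
        simp only [Cinf.mk_apply, AlternatingMap.map_update_add, Cinf.add_apply]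
      map_update_smul' := fun a k r b => Cinf.ext fun x => by
        rw [smul_eq_mul, Cinf.mul_apply]
        simp only [Cinf.mk_apply, AlternatingMap.map_update_smul, Algebra.smul_def,
          Cinf.mul_apply, algebraMap_restrict_apply]
      map_eq_zero_of_eq' := fun a k l hkl hne => Cinf.ext fun x => by
        simp only [Cinf.mk_apply, AlternatingMap.map_eq_zero_of_eq _ a hkl hne, Cinf.zero_apply] }
  refine ⟨Ω, fun i a => Cinf.ext fun x => ?_⟩
  exact hη a _ _ x x.2 (hidx x)

end Atlas

end LieAlgebroid

theorem mainTheorem6 {𝕜 : Type*} [RCLike 𝕜]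
    {E : Type*} [NormedAddCommGroup E] [NormedSpace ℝ E] [FiniteDimensional ℝ E]
    {M : Type*} [TopologicalSpace M] [ChartedSpace E M] [T2Space M] [SigmaCompactSpace M]
    [IsManifold 𝓘(ℝ, E) ∞ M]
    {A : Type*} [LieRing A] [Module (Cinf 𝕜 E M) A]
    (𝔸 : LieAlgebroid 𝕜 E M A) (_transitive : 𝔸.IsTransitive)
    {𝔤 : Type*} [LieRing 𝔤] [LieAlgebra 𝕜 𝔤] {n : ℕ} (e : Module.Basis (Fin n) 𝕜 𝔤)
    {ι : Type*} (𝓐 : 𝔸.Atlas 𝔤 ι) (_oriented : 𝓐.IsOriented e)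
    (conn : 𝔸.Connection)
    (h : LinearMap.BilinForm (Cinf 𝕜 E M) 𝔸.kernel) (_symm : ∀ ℓ ℓ', h ℓ ℓ' = h ℓ' ℓ)
    (_nondegenerate : 𝔸.FiberwiseNondegenerate h) :
    ∃ σ : ∀ i, Cinf 𝕜 E (𝓐.U i),
      (∀ i x, σ i x = (((𝓐.triv i).sqrtAbsDet e conn h x : ℝ) : 𝕜)) ∧
      (∀ i j,
        LieAlgebroid.LocalTrivialization.transport (𝓐.trivFst i j) (𝓐.trivSnd i j)
            (restrictLE (V := 𝓐.U i ⊓ 𝓐.U j) inf_le_left (σ i) • (𝓐.trivFst i j).mixedTopForm e conn) =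
          restrictLE (V := 𝓐.U i ⊓ 𝓐.U j) inf_le_right (σ j) • (𝓐.trivSnd i j).mixedTopForm e conn) ∧
      ∃ Ω : A [⋀^Fin n]→ₗ[Cinf 𝕜 E M] Cinf 𝕜 E M,
        (∀ i, (𝓐.triv i).IsLocalExpression Ω
          (((-1 : Cinf 𝕜 E (𝓐.U i)) ^ n * σ i) • (𝓐.triv i).mixedTopForm e conn)) ∧
        (∀ Ω' : A [⋀^Fin n]→ₗ[Cinf 𝕜 E M] Cinf 𝕜 E M,
          (∀ i, (𝓐.triv i).IsLocalExpression Ω'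
            (((-1 : Cinf 𝕜 E (𝓐.U i)) ^ n * σ i) • (𝓐.triv i).mixedTopForm e conn)) →
          Ω' = Ω) ∧
        𝓐.IsInnerIntegral e conn h Ω 1 := by
  refine ⟨fun i => (𝓐.triv i).sqrtAbsDetSmooth e conn h _nondegenerate, fun _ _ => rfl,
    𝓐.transport_sqrtAbsDet_smul_mixedTopForm e conn h _nondegenerate _oriented, ?_⟩
  obtain ⟨Ω, hΩ⟩ := 𝓐.exists_isLocalExpression (𝓐.localVolume e conn h _nondegenerate)
    (𝓐.localVolume_agree e conn h _nondegenerate _oriented)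
  refine ⟨Ω, hΩ, fun Ω' hΩ' => ?_, fun i η hη x => ?_⟩
  · refine AlternatingMap.ext fun a => Cinf.ext fun x => ?_
    obtain ⟨i, hi⟩ := 𝓐.cover x
    exact congrArg (fun f => f ⟨x, hi⟩) ((hΩ' i a).symm.trans (hΩ i a))
  · rw [hη.unique (hΩ i), LieAlgebroid.Atlas.localVolume, AlternatingMap.smul_apply,
      LieAlgebroid.LocalTrivialization.mixedTopForm_sectionBasis, smul_eq_mul, mul_right_comm,
      ← mul_pow, neg_one_mul, neg_neg, one_pow]
    rfl
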